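/- **Conventions.** A *control function* is a nondecreasing function $\rho:\mathbb R_+\to\mathbb R_+$ with $\rho(t)\to\infty$ as $t\to\infty$. A metric space $X$ *coarsely embeds into Hilbert space* if there are a Hilbert space $H$, a map $F:X\to H$ and control functions $\rho_\pm$ with $\rho_-(d(x,x'))\le\|F(x)-F(x')\|\le\rho_+(d(x,x'))$ for all $x,x'\in X$. A *coarse disjoint union* $\bigsqcup_n X_n$ of a sequence of metric spaces is a metric space $X$ with a map $p:X\to\mathbb N$ such that $p^{-1}(n)$ is isometric to $X_n$ for every $n$; $|2^{p(x)}-2^{p(y)}|\le\rho(d(x,y))$ for all $x,y\in X$ and some control function $\rho$; and for all $i\ne j$ and all $R$ the set of points of $p^{-1}(i)$ at distance at most $R$ from some point of $p^{-1}(j)$ is bounded. (It is unique up to coarse equivalence.) A *proper length* on a group $G$ is a function $\ell:G\to\mathbb R_+$ with $\ell(gh)\le\ell(g)+\ell(h)$, $\ell(g^{-1})=\ell(g)$, $\ell(g)=0\iff g=1$, and $\{\ell\le R\}$ finite for every $R$; for a normal subgroup $N$ the quotient metric on $G/N$ is $d(x,y)=\inf\{\ell(g): gN=x^{-1}y\}$.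 A sequence $(N_n)_{n\in\mathbb N}$ of finite-index normal subgroups of a group $G$ *has embeddable quotients* if, for some proper length on $G$, the coarse disjoint union $\bigsqcup_n G/N_n$ of the quotients with their quotient metrics coarsely embeds into Hilbert space. If moreover $\bigcap_n N_n=\{1\}$, this coarse disjoint union is an *embeddable box space* of $G$. For a subgroup $K\le G$ of finite index and a finite generating set $S$ of $G$, the Schreier graph $X_S(K)$ has vertex set $G/K$ and edges joining $z$ and $sz$ ($z\in G/K$, $s\in S$); it is endowed with its path metric. **Proposition.** Let $A$ and $B$ be finitely generated residually finite groups, let $G=A\star B$ be their free product, and let $S$ be a finite generating set of $G$. 1. If $A$ and $B$ each have an embeddable box space, then there is a sequence $(K_n)_{n\in\mathbb N}$ of finite-index (not necessarily normal) subgroups of $G$ with $\bigcap_n K_n=\{1\}$ such that the coarse disjoint union $\bigsqcup_n X_S(K_n)$ of the Schreier graphs of the transitive actions of $G$ on $G/K_n$ coarsely embeds into Hilbert space. 2. Suppose that $A$ has a sequence $(N_n)$ and $B$ a sequence $(M_n)$ of finite-index normal subgroups with embeddable quotients such that every nontrivial element of $A$ (respectively $B$) lies in only finitely many of the $N_n$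 (respectively $M_n$). Then there is a sequence $(K_n)$ of finite-index subgroups of $G$ such that every nontrivial element of $G$ lies in only finitely many of the $K_n$ (in particular it acts non-trivially on all but finitely many $G/K_n$) and $\bigsqcup_n X_S(K_n)$ coarsely embeds into Hilbert space. -/

import Mathlib

open Filter Topology
open scoped NNReal

universe u v

namespace CoarseUnion

/-- A control function `ℝ₊ → ℝ₊`: nondecreasing and tending to infinity at infinity. For the bounds
in a coarse embedding this amounts to properness. -/
structure IsControl (ρ : ℝ≥0 → ℝ≥0) : Prop where
  monotone : Monotone ρ
  tendsto : Tendsto ρ atTop atTop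

/-- `X` coarsely embeds into `Y`. -/
def CoarselyEmbeds (X : Type*) (Y : Type*) [MetricSpace X] [MetricSpace Y] : Prop :=
  ∃ (F : X → Y) (ρ₁ ρ₂ : ℝ≥0 → ℝ≥0), IsControl ρ₁ ∧ IsControl ρ₂ ∧
    ∀ x x' : X, ρ₁ (nndist x x') ≤ nndist (F x) (F x') ∧ nndist (F x) (F x') ≤ ρ₂ (nndist x x')

/-- `X` coarsely embeds into some (real) Hilbert space. -/
def CoarselyEmbedsIntoHilbert (X : Type u) [MetricSpace X] : Prop :=
  ∃ (H : Type u) (_ : NormedAddCommGroup H) (_ : InnerProductSpace ℝ H) (_ : CompleteSpace H),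
    CoarselyEmbeds X H

/-- The metric space `Y`, with its projection `p : Y → ℕ`, is a coarse disjoint union of the
sequence of metric spaces `(X n, m n)`: the fibre over `n` is isometric to `X n`, the projection is
controlled for the distance `|2 ^ i - 2 ^ j|` on `ℕ`, and the set of points of a fibre that are at
bounded distance from another given fibre is bounded. -/
structure IsCoarseDisjointUnion {X : ℕ → Type*} (m : ∀ n, MetricSpace (X n))
    {Y : Type*} [MetricSpace Y] (p : Y → ℕ) : Prop where
  isometric : ∀ n, Nonempty (X n ≃ᵢ p ⁻¹' {n})
  far_away : ∃ ρ : ℝ≥0 → ℝ≥0, IsControl ρ ∧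
    ∀ x y : Y, |(2 : ℝ) ^ p x - 2 ^ p y| ≤ ρ (nndist x y)
  bounded : ∀ i j : ℕ, i ≠ j → ∀ R : ℝ,
    Bornology.IsBounded {x : Y | p x = i ∧ ∃ y : Y, p y = j ∧ dist x y ≤ R}

/-- The coarse disjoint union of the metric spaces `(X n, m n)` (which is unique up to coarse
equivalence) coarsely embeds into Hilbert space. -/
def CoarseDisjointUnionEmbeds {X : ℕ → Type u} (m : ∀ n, MetricSpace (X n)) : Prop :=
  ∃ (Y : Type u) (_ : MetricSpace Y) (p : Y → ℕ),
    IsCoarseDisjointUnion m p ∧ CoarselyEmbedsIntoHilbert Y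

/-! ### Proper lengths and quotient metrics -/

/-- A proper length function on a discrete group. -/
structure ProperLength (G : Type*) [Group G] where
  len : G → ℝ
  nonneg : ∀ g, 0 ≤ len g
  mul_le : ∀ g h, len (g * h) ≤ len g + len h
  inv : ∀ g, len g⁻¹ = len g
  eq_zero : ∀ g, len g = 0 ↔ g = 1
  proper : ∀ R : ℝ, {g | len g ≤ R}.Finite

namespace ProperLength

variable {G : Type*} [Group G] (ℓ : ProperLength G) (N : Subgroup G)

/-- The quotient length `q ↦ inf {ℓ g | g ∈ q}` on `G ⧸ N`; for `q = gN` this is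
`inf {ℓ (g * h) | h ∈ N}`. -/
noncomputable def quotientLen (q : G ⧸ N) : ℝ :=
  sInf (ℓ.len '' {g : G | (g : G ⧸ N) = q})

theorem quotientLen_le (g : G) : ℓ.quotientLen N (g : G ⧸ N) ≤ ℓ.len g :=
  csInf_le ⟨0, by rintro _ ⟨g, -, rfl⟩; exact ℓ.nonneg g⟩ ⟨g, rfl, rfl⟩

theorem quotientLen_nonneg (q : G ⧸ N) : 0 ≤ ℓ.quotientLen N q :=
  Real.sInf_nonneg (by rintro _ ⟨g, -, rfl⟩; exact ℓ.nonneg g)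

theorem exists_quotientLen_eq (q : G ⧸ N) :
    ∃ g : G, (g : G ⧸ N) = q ∧ ℓ.len g = ℓ.quotientLen N q := by
  obtain ⟨g₀, hg₀⟩ := QuotientGroup.mk_surjective q
  let T : Set G := {g | (g : G ⧸ N) = q ∧ ℓ.len g ≤ ℓ.len g₀}
  have hT : T.Finite := (ℓ.proper (ℓ.len g₀)).subset fun g hg => hg.2
  obtain ⟨g, hg, hmin⟩ := T.exists_min_image ℓ.len hT ⟨g₀, hg₀, le_rfl⟩
  refine ⟨g, hg.1, le_antisymm ?_ ?_⟩
  · refine le_csInf ⟨_, g, hg.1, rfl⟩ ?_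
    rintro _ ⟨k, hk, rfl⟩
    by_cases h : ℓ.len k ≤ ℓ.len g₀
    · exact hmin k ⟨hk, h⟩
    · exact hg.2.trans (not_le.mp h).le
  · have := ℓ.quotientLen_le N g
    rwa [hg.1] at this

/-- The metric `d(x, y) = ℓ_{G/N}(x⁻¹ y)` on `G ⧸ N` given by the quotient length. -/
@[reducible]
noncomputable def quotientMetric [N.Normal] : MetricSpace (G ⧸ N) where
  dist x y := ℓ.quotientLen N (x⁻¹ * y)
  dist_self x := by
    refine le_antisymm ?_ (ℓ.quotientLen_nonneg N _)
    have := ℓ.quotientLen_le N 1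
    rwa [(ℓ.eq_zero 1).2 rfl, QuotientGroup.mk_one, ← inv_mul_cancel x] at this
  dist_comm := by
    have key : ∀ x y : G ⧸ N, ℓ.quotientLen N (x⁻¹ * y) ≤ ℓ.quotientLen N (y⁻¹ * x) := by
      intro x y
      obtain ⟨g, hg, hl⟩ := ℓ.exists_quotientLen_eq N (y⁻¹ * x)
      have := ℓ.quotientLen_le N g⁻¹
      rwa [QuotientGroup.mk_inv, hg, ℓ.inv, hl, mul_inv_rev, inv_inv] at this
    exact fun x y => le_antisymm (key x y) (key y x)
  dist_triangle x y z := by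
    obtain ⟨g, hg, hl⟩ := ℓ.exists_quotientLen_eq N (x⁻¹ * y)
    obtain ⟨h, hh, hl'⟩ := ℓ.exists_quotientLen_eq N (y⁻¹ * z)
    have h1 := (ℓ.quotientLen_le N (g * h)).trans (ℓ.mul_le g h)
    rw [QuotientGroup.mk_mul, hg, hh, hl, hl'] at h1
    have e : x⁻¹ * y * (y⁻¹ * z) = x⁻¹ * z := by group
    rwa [e] at h1
  eq_of_dist_eq_zero := by
    intro x y h
    obtain ⟨g, hg, hl⟩ := ℓ.exists_quotientLen_eq N (x⁻¹ * y)
    have h0 : ℓ.len g = 0 := hl.trans h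
    rw [ℓ.eq_zero] at h0
    rw [h0, QuotientGroup.mk_one] at hg
    exact (inv_mul_eq_one.mp hg.symm)

end ProperLength

/-- The `N n` are finite-index normal subgroups of `G`, and the coarse disjoint union of the finite
groups `G ⧸ N n`, each with the quotient metric of a proper length of `G`, coarsely embeds into
Hilbert space. -/
def QuotientsEmbed {G : Type u} [Group G] (N : ℕ → Subgroup G) : Prop :=
  (∀ n, (N n).FiniteIndex) ∧ ∃ (_ : ∀ n, (N n).Normal) (ℓ : ProperLength G),
    CoarseDisjointUnionEmbeds fun n => ℓ.quotientMetric (N n)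

/-! ### Schreier graphs -/

section Schreier

variable {G : Type*} [Group G] (S : Set G) (Z : Type*) [MulAction G Z]

/-- The (undirected, loops and multiplicities removed) Schreier graph of an action of `G` on `Z`:
`z` and `s • z` are joined by an edge for `s ∈ S`. -/
def schreierGraph : SimpleGraph Z :=
  SimpleGraph.fromRel fun z z' => ∃ s ∈ S, z' = s • z

theorem schreierGraph_reachable_smul {s : G} (hs : s ∈ S) (z : Z) :
    (schreierGraph S Z).Reachable z (s • z) := by
  by_cases h : z = s • z
  · rw [← h]
  · exact SimpleGraph.Adj.reachable ((SimpleGraph.fromRel_adj _ _ _).2 ⟨h, Or.inl ⟨s, hs, rfl⟩⟩)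

theorem schreierGraph_connected (hS : Subgroup.closure S = ⊤) [MulAction.IsPretransitive G Z]
    [Nonempty Z] : (schreierGraph S Z).Connected := by
  have key : ∀ g : G, ∀ z : Z, (schreierGraph S Z).Reachable z (g • z) := by
    intro g
    have hg : g ∈ Subgroup.closure S := hS ▸ Subgroup.mem_top g
    induction hg using Subgroup.closure_induction with
    | mem s hs => exact schreierGraph_reachable_smul S Z hs
    | one => intro z; rw [one_smul]
    | mul a b _ _ iha ihb => intro z; rw [mul_smul]; exact (ihb z).trans (iha (b • z))
    | inv a _ iha => intro z; simpa using (iha (a⁻¹ • z)).symm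
  refine { preconnected := fun x y => ?_ }
  obtain ⟨g, rfl⟩ := MulAction.exists_smul_eq G x y
  exact key g x

/-- The path metric on the vertices of the Schreier graph of a transitive action, for a
generating set `S`. -/
@[reducible]
noncomputable def schreierMetric (hS : Subgroup.closure S = ⊤) [MulAction.IsPretransitive G Z]
    [Nonempty Z] : MetricSpace Z where
  dist x y := ((schreierGraph S Z).dist x y : ℝ)
  dist_self x := by simp
  dist_comm x y := by rw [SimpleGraph.dist_comm]
  dist_triangle x y z := by
    exact_mod_cast (schreierGraph_connected S Z hS).dist_triangle
  eq_of_dist_eq_zero := by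
    intro x y h
    exact (schreierGraph_connected S Z hS).dist_eq_zero_iff.mp (by exact_mod_cast h)

end Schreier

end CoarseUnion

/-! The free product acts on finite trees of cosets. Letters are cosets of the `N n` and `M n`, each
coset space being a piece marked at its trivial coset; a vertex is an alternating word of at most
`d` unmarked letters. Each factor acts on the first letter of its kind, an absent letter counting as
the marked point, and acts trivially if there is no room for one. Indices of pieces are counted from
the end of the word, so changing the front leaves the rest legal. `K` is the stabilizer of the empty
word.

Embedding (`coarseDisjointUnionEmbeds_wordStabilizer`): send a word to the sum of the displacements
of its letters from the marked points, with one orthogonal copy of Hilbert space for each tail and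
kind. An element of a factor changes one letter, so it moves images by a bounded amount
(`norm_wordMap_move_sub_le`). Conversely, displacements have norm at least 1, so words with images
at distance at most `R` are linked by a number of letter changes bounded in terms of `R`, each made
by one of finitely many group elements (`exists_finite_wordMap`). All bounds are independent of `σ`
and `d`.

Separation (`sylProd_notMem_wordStabilizer`): if each syllable of a nonempty alternating product
lies outside the subgroup at its position, applying the product to the empty word adds one letter
per syllable. For trivial intersection, `σ` runs over all finite lists of indices; for eventual
separation, `σ` is constantly `n` and `d = n`. -/

namespace CoarseUnion

/-! ### Coarse disjoint unions and equi-coarse embeddings -/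

section SigmaUnion

variable {X : ℕ → Type u} [∀ n, MetricSpace (X n)] (z : ∀ n, X n)

/-- The distance on a disjoint union of pointed metric spaces in which passing from the base point
of the `i`-th space to the base point of the `j`-th one costs `|2 ^ i - 2 ^ j|`. -/
noncomputable def unionDist : (Σ n, X n) → (Σ n, X n) → ℝ
  | ⟨i, x⟩, ⟨j, y⟩ => if h : i = j then dist (h ▸ x) y
      else dist x (z i) + |(2 : ℝ) ^ i - 2 ^ j| + dist (z j) y

theorem unionDist_same (i : ℕ) (x y : X i) : unionDist z ⟨i, x⟩ ⟨i, y⟩ = dist x y := by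
  simp [unionDist]

theorem unionDist_of_ne {i j : ℕ} (h : i ≠ j) (x : X i) (y : X j) :
    unionDist z ⟨i, x⟩ ⟨j, y⟩ = dist x (z i) + |(2 : ℝ) ^ i - 2 ^ j| + dist (z j) y := by
  simp [unionDist, h]

theorem unionDist_comm (p q : Σ n, X n) : unionDist z p q = unionDist z q p := by
  obtain ⟨i, x⟩ := p
  obtain ⟨j, y⟩ := q
  rcases eq_or_ne i j with rfl | h
  · rw [unionDist_same, unionDist_same, dist_comm]
  · rw [unionDist_of_ne z h, unionDist_of_ne z h.symm, dist_comm x, dist_comm _ y, abs_sub_comm]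
    ring

theorem unionDist_triangle (p q r : Σ n, X n) :
    unionDist z p r ≤ unionDist z p q + unionDist z q r := by
  obtain ⟨i, x⟩ := p
  obtain ⟨j, y⟩ := q
  obtain ⟨k, w⟩ := r
  rcases eq_or_ne i j with rfl | hij
  · rcases eq_or_ne i k with rfl | hik
    · simpa only [unionDist_same] using dist_triangle x y w
    · rw [unionDist_same, unionDist_of_ne z hik, unionDist_of_ne z hik]
      linarith [dist_triangle x y (z i)]
  · rcases eq_or_ne j k with rfl | hjk
    · rw [unionDist_same, unionDist_of_ne z hij, unionDist_of_ne z hij]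
      linarith [dist_triangle (z j) y w]
    · rw [unionDist_of_ne z hij, unionDist_of_ne z hjk]
      rcases eq_or_ne i k with rfl | hik
      · rw [unionDist_same]
        linarith [dist_triangle x (z i) w, abs_nonneg ((2 : ℝ) ^ i - 2 ^ j),
          abs_nonneg ((2 : ℝ) ^ j - 2 ^ i), dist_nonneg (x := z j) (y := y),
          dist_nonneg (x := y) (y := z j)]
      · rw [unionDist_of_ne z hik]
        linarith [abs_sub_le ((2 : ℝ) ^ i) (2 ^ j) (2 ^ k), dist_nonneg (x := z j) (y := y),
          dist_nonneg (x := y) (y := z j)]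

theorem abs_two_pow_sub_le_unionDist (p q : Σ n, X n) :
    |(2 : ℝ) ^ p.1 - 2 ^ q.1| ≤ unionDist z p q := by
  obtain ⟨i, x⟩ := p
  obtain ⟨j, y⟩ := q
  rcases eq_or_ne i j with rfl | h
  · simp [unionDist_same]
  · rw [unionDist_of_ne z h]
    linarith [dist_nonneg (x := x) (y := z i), dist_nonneg (x := z j) (y := y)]

/-- The metric given by `unionDist`. -/
@[reducible]
noncomputable def unionMetric : MetricSpace (Σ n, X n) where
  dist := unionDist z
  dist_self := fun ⟨i, x⟩ => by simp [unionDist_same]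
  dist_comm := unionDist_comm z
  dist_triangle := unionDist_triangle z
  eq_of_dist_eq_zero := by
    intro p q h
    change unionDist z p q = 0 at h
    have h0 := abs_two_pow_sub_le_unionDist z p q
    rw [h] at h0
    have h1 : (2 : ℝ) ^ p.1 = 2 ^ q.1 := sub_eq_zero.1 (abs_nonpos_iff.1 h0)
    have h2 : p.1 = q.1 := pow_right_injective₀ two_pos (by norm_num) h1
    obtain ⟨i, x⟩ := p
    obtain ⟨j, y⟩ := q
    obtain rfl : i = j := h2
    rw [unionDist_same, dist_eq_zero] at h
    rw [h]

end SigmaUnion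

theorem isControl_id : IsControl id := ⟨monotone_id, tendsto_id⟩

theorem isCoarseDisjointUnion_unionMetric {X : ℕ → Type u} (m : ∀ n, MetricSpace (X n)) (z : ∀ n, X n) :
    @IsCoarseDisjointUnion X m (Σ n, X n) (unionMetric z) Sigma.fst := by
  let _ := unionMetric z
  refine ⟨fun n => ⟨?_⟩, ⟨id, isControl_id, fun p q => ?_⟩, fun i j hij R => ?_⟩
  · refine IsometryEquiv.mk' (fun x => ⟨⟨n, x⟩, rfl⟩) (fun p => p.2 ▸ p.1.2) ?_ ?_
    · rintro ⟨⟨k, x⟩, rfl⟩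
      rfl
    · exact Isometry.of_dist_eq fun x y => unionDist_same z n x y
  · exact abs_two_pow_sub_le_unionDist z p q
  · refine (Metric.isBounded_closedBall (x := (⟨i, z i⟩ : Σ n, X n)) (r := R)).subset ?_
    rintro ⟨k, x⟩ ⟨rfl, ⟨l, y⟩, rfl, h⟩
    change unionDist z _ _ ≤ R at h
    rw [unionDist_of_ne z hij] at h
    change unionDist z _ _ ≤ R
    rw [unionDist_same]
    linarith [abs_nonneg ((2 : ℝ) ^ k - 2 ^ l), dist_nonneg (x := z l) (y := y)]

/-- A Lipschitz map under which points with close images are close is a coarse embedding. -/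
theorem coarselyEmbeds_of_bounds {X Y : Type*} [MetricSpace X] [MetricSpace Y] (F : X → Y)
    (C : ℝ≥0) (hC : ∀ x y, dist (F x) (F y) ≤ C * dist x y)
    (hL : ∀ R : ℝ, ∃ R' : ℝ, ∀ x y, dist (F x) (F y) ≤ R → dist x y ≤ R') :
    CoarselyEmbeds X Y := by
  -- The ray keeps the set nonempty when no two points are `t` apart; the infimum over the empty set
  -- would be 0 and spoil divergence.
  let T : ℝ≥0 → Set ℝ≥0 := fun t =>
    {s | t ≤ s} ∪ {s | ∃ x y : X, t ≤ nndist x y ∧ s = nndist (F x) (F y)}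
  have hT : ∀ t, (T t).Nonempty := fun t => ⟨t, Or.inl (le_refl t)⟩
  -- The extra `t` in the upper control makes it diverge even if `C = 0`.
  refine ⟨F, fun t => sInf (T t), fun t => C * t + t, ⟨?_, ?_⟩, ⟨?_, ?_⟩, fun x y => ⟨?_, ?_⟩⟩
  · intro s t hst
    refine csInf_le_csInf (OrderBot.bddBelow _) (hT t) ?_
    rintro r (hr | ⟨x, y, hxy, rfl⟩)
    · exact Or.inl (le_trans hst hr)
    · exact Or.inr ⟨x, y, hst.trans hxy, rfl⟩
  · refine tendsto_atTop.2 fun R => ?_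
    obtain ⟨R', hR'⟩ := hL R
    filter_upwards [eventually_gt_atTop (max R R'.toNNReal)] with t ht
    refine le_csInf (hT t) ?_
    rintro r (hr | ⟨x, y, hxy, rfl⟩)
    · exact (le_max_left _ _).trans (ht.le.trans hr)
    · by_contra! hlt
      have h1 : dist x y ≤ R' := hR' x y (by exact_mod_cast hlt.le)
      have h2 : nndist x y ≤ R'.toNNReal := by
        rw [← Real.toNNReal_coe (r := nndist x y)]
        exact Real.toNNReal_le_toNNReal h1
      exact absurd (hxy.trans (h2.trans (le_max_right _ _))) (not_le.2 ht)
  · intro s t hst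
    dsimp only
    gcongr
  · exact tendsto_atTop_mono (fun t => le_add_of_nonneg_left (zero_le)) tendsto_id
  · exact csInf_le (OrderBot.bddBelow _) (Or.inr ⟨x, y, le_rfl, rfl⟩)
  · refine le_add_right ?_
    exact_mod_cast hC x y

/-! ### Gluing Hilbert-valued maps orthogonally -/

section Embedding

variable {X : ℕ → Type u} {V : Type u} [NormedAddCommGroup V] [InnerProductSpace ℝ V]

/-- Put the images of the `n`-th space in the `n`-th summand of an orthogonal sum, and record `n`
in one more coordinate. -/
noncomputable def unionMap (f : ∀ n, X n → V) (z : ∀ n, X n) (p : Σ n, X n) :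
    WithLp 2 (lp (fun _ : ULift.{u} ℕ => V) 2 × ℝ) :=
  WithLp.toLp 2 (lp.single 2 (ULift.up p.1) (f p.1 p.2 - f p.1 (z p.1)), (2 : ℝ) ^ p.1)

theorem norm_toLp_le {E F : Type*} [SeminormedAddCommGroup E] [SeminormedAddCommGroup F]
    (a : E) (b : F) : ‖WithLp.toLp 2 (a, b)‖ ≤ ‖a‖ + ‖b‖ := by
  refine le_of_sq_le_sq ?_ (by positivity)
  rw [WithLp.prod_norm_sq_eq_of_L2]
  change ‖a‖ ^ 2 + ‖b‖ ^ 2 ≤ _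
  nlinarith [norm_nonneg a, norm_nonneg b]

/-- A sequence of metric spaces with uniformly Lipschitz, uniformly proper maps to a Hilbert space
has an embeddable coarse disjoint union. -/
theorem coarseDisjointUnionEmbeds_of_bounds [CompleteSpace V] (m : ∀ n, MetricSpace (X n))
    (z : ∀ n, X n) (f : ∀ n, X n → V) (C : ℝ≥0)
    (hC : ∀ n x y, dist (f n x) (f n y) ≤ C * dist x y)
    (hL : ∀ R : ℝ, ∃ R' : ℝ, ∀ n x y, dist (f n x) (f n y) ≤ R → dist x y ≤ R') :
    CoarseDisjointUnionEmbeds m := by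
  refine ⟨Σ n, X n, unionMetric z, Sigma.fst, isCoarseDisjointUnion_unionMetric m z,
    WithLp 2 (lp (fun _ : ULift.{u} ℕ => V) 2 × ℝ), inferInstance, inferInstance, inferInstance, ?_⟩
  let _ := unionMetric z
  have hsame : ∀ i (x y : X i), dist (unionMap f z ⟨i, x⟩) (unionMap f z ⟨i, y⟩) =
      dist (f i x) (f i y) := by
    intro i x y
    have h : unionMap f z ⟨i, x⟩ - unionMap f z ⟨i, y⟩ =
        WithLp.toLp 2 (lp.single 2 (ULift.up i) (f i x - f i y), (0 : ℝ)) := by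
      rw [unionMap, unionMap, ← WithLp.toLp_sub, Prod.mk_sub_mk, ← lp.single_sub]
      simp
    rw [dist_eq_norm, h, dist_eq_norm, ← sq_eq_sq₀ (norm_nonneg _) (norm_nonneg _),
      WithLp.prod_norm_sq_eq_of_L2]
    change ‖lp.single (E := fun _ : ULift.{u} ℕ => V) 2 (ULift.up i) (f i x - f i y)‖ ^ 2 +
      ‖(0 : ℝ)‖ ^ 2 = _
    rw [lp.norm_single two_pos, norm_zero]
    ring
  refine coarselyEmbeds_of_bounds (unionMap f z) (C + 1) ?_ ?_
  · rintro ⟨i, x⟩ ⟨j, y⟩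
    change _ ≤ _ * unionDist z _ _
    rcases eq_or_ne i j with rfl | hij
    · rw [hsame, unionDist_same]
      refine (hC _ _ _).trans ?_
      gcongr
      simp
    · rw [dist_eq_norm, unionMap, unionMap, ← WithLp.toLp_sub, Prod.mk_sub_mk,
        unionDist_of_ne z hij]
      refine (norm_toLp_le _ _).trans ?_
      have h1 := norm_sub_le (lp.single (E := fun _ : ULift.{u} ℕ => V) 2 (ULift.up i)
        (f i x - f i (z i))) (lp.single 2 (ULift.up j) (f j y - f j (z j)))
      rw [lp.norm_single two_pos, lp.norm_single two_pos, ← dist_eq_norm (f i x),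
        ← dist_eq_norm (f j y)] at h1
      have h2 := hC i x (z i)
      have h3 := hC j y (z j)
      rw [dist_comm y] at h3
      have h4 : 0 ≤ (C : ℝ) * |(2 : ℝ) ^ i - 2 ^ j| := by positivity
      rw [Real.norm_eq_abs]
      push_cast
      linarith [dist_nonneg (x := x) (y := z i), dist_nonneg (x := z j) (y := y)]
  · intro R
    obtain ⟨R', hR'⟩ := hL R
    -- Across two fibres, each summand bounds the distance to a base point by `R'`, and the last
    -- coordinate bounds `|2 ^ i - 2 ^ j|` by `R`.
    refine ⟨R' + |R| + |R'|, ?_⟩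
    rintro ⟨i, x⟩ ⟨j, y⟩ h
    change unionDist z _ _ ≤ _
    rcases eq_or_ne i j with rfl | hij
    · rw [hsame] at h
      rw [unionDist_same]
      linarith [hR' i x y h, abs_nonneg R, abs_nonneg R']
    · rw [dist_eq_norm, unionMap, unionMap, ← WithLp.toLp_sub, Prod.mk_sub_mk] at h
      have h1 := (WithLp.norm_fst_le _ _).trans h
      have h2 := (WithLp.norm_snd_le _ _).trans h
      have h3 := (lp.norm_apply_le_norm two_ne_zero _ (ULift.up i)).trans h1
      have h4 := (lp.norm_apply_le_norm two_ne_zero _ (ULift.up j)).trans h1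
      simp [hij, hij.symm] at h2 h3 h4
      rw [← dist_eq_norm] at h3 h4
      have h5 := hR' _ _ _ h3
      have h6 := hR' _ _ _ h4
      rw [unionDist_of_ne z hij]
      have h7 := h2.trans (le_abs_self R)
      linarith [le_abs_self R']

end Embedding

/-! ### Schreier graphs -/

section SchreierGraph

variable {G : Type*} [Group G] {S : Set G}

theorem schreierGraph_adj_iff {Z : Type*} [MulAction G Z] {x y : Z} :
    (schreierGraph S Z).Adj x y ↔ x ≠ y ∧ ((∃ s ∈ S, y = s • x) ∨ ∃ s ∈ S, x = s • y) :=
  SimpleGraph.fromRel_adj _ _ _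

/-- Writing `g` as a word in `S` bounds its displacement by the length of the word, hence by the
same `k` in every Schreier graph. -/
theorem exists_schreierGraph_dist_smul_le (hS : Subgroup.closure S = ⊤) (g : G) :
    ∃ k : ℕ, ∀ (Z : Type u) [MulAction G Z] [MulAction.IsPretransitive G Z] [Nonempty Z] (z : Z),
      (schreierGraph S Z).dist z (g • z) ≤ k := by
  have hg : g ∈ Subgroup.closure S := hS ▸ Subgroup.mem_top g
  induction hg using Subgroup.closure_induction with
  | mem s hs =>
    refine ⟨1, fun Z _ _ _ z => ?_⟩
    by_cases h : z = s • z
    · simp [← h]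
    · exact (SimpleGraph.dist_eq_one_iff_adj.2
        (schreierGraph_adj_iff.2 ⟨h, Or.inl ⟨s, hs, rfl⟩⟩)).le
  | one => exact ⟨0, fun Z _ _ _ z => by simp⟩
  | mul a b _ _ iha ihb =>
    obtain ⟨k, hk⟩ := iha
    obtain ⟨l, hl⟩ := ihb
    refine ⟨l + k, fun Z _ _ _ z => ?_⟩
    rw [mul_smul]
    exact (schreierGraph_connected S Z hS).dist_triangle.trans (add_le_add (hl Z z) (hk Z _))
  | inv a _ iha =>
    obtain ⟨k, hk⟩ := iha
    refine ⟨k, fun Z _ _ _ z => ?_⟩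
    simpa [SimpleGraph.dist_comm] using hk Z (a⁻¹ • z)

theorem dist_le_mul_schreierGraph_dist (hS : Subgroup.closure S = ⊤) {Z Y : Type*} [MulAction G Z]
    [MulAction.IsPretransitive G Z] [Nonempty Z] [PseudoMetricSpace Y] (f : Z → Y) (C : ℝ)
    (hC : ∀ s ∈ S, ∀ z, dist (f (s • z)) (f z) ≤ C) (x y : Z) :
    dist (f x) (f y) ≤ C * (schreierGraph S Z).dist x y := by
  obtain ⟨p, hp⟩ := (schreierGraph_connected S Z hS).exists_walk_length_eq_dist x y
  rw [← hp]
  clear hp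
  induction p with
  | nil => simp
  | @cons a b c h p ih =>
    have h1 : dist (f a) (f b) ≤ C := by
      obtain ⟨-, ⟨s, hs, rfl⟩ | ⟨s, hs, rfl⟩⟩ := schreierGraph_adj_iff.1 h
      · rw [dist_comm]
        exact hC s hs a
      · exact hC s hs b
    rw [SimpleGraph.Walk.length_cons]
    push_cast
    linarith [dist_triangle (f a) (f b) (f c)]

end SchreierGraph

/-- Maps from a sequence of `G`-sets to a Hilbert space which are displaced by a bounded amount by
every element of `G`, and under which points with close images differ by finitely many elements of
`G`, yield an embedding of the coarse disjoint union of Schreier graphs of orbits. -/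
theorem coarseDisjointUnionEmbeds_schreier {G : Type u} [Group G] {S : Set G} (hSfin : S.Finite)
    (hS : Subgroup.closure S = ⊤) {V : Type u} [NormedAddCommGroup V] [InnerProductSpace ℝ V]
    [CompleteSpace V] {Z : ℕ → Type*} [∀ n, MulAction G (Z n)] (z : ∀ n, Z n) (F : ∀ n, Z n → V)
    (hU : ∀ g : G, ∃ C : ℝ, ∀ n x, ‖F n (g • x) - F n x‖ ≤ C)
    (hL : ∀ R : ℝ, ∃ E : Set G, E.Finite ∧
      ∀ n x y, ‖F n x - F n y‖ ≤ R → ∃ g ∈ E, g • x = y) :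
    CoarseDisjointUnionEmbeds
      fun n => schreierMetric S (G ⧸ MulAction.stabilizer G (z n)) hS := by
  choose C hC using hU
  obtain ⟨D, hD⟩ : ∃ D : ℝ≥0, ∀ s ∈ S, C s ≤ D := by
    obtain ⟨D, hD⟩ := (hSfin.image C).bddAbove
    exact ⟨D.toNNReal, fun s hs => (hD ⟨s, hs, rfl⟩).trans (Real.le_coe_toNNReal D)⟩
  refine coarseDisjointUnionEmbeds_of_bounds _
    (fun n => ((1 : G) : G ⧸ MulAction.stabilizer G (z n)))
    (fun n q => F n (MulAction.ofQuotientStabilizer G (z n) q)) D ?_ ?_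
  · intro n x y
    refine dist_le_mul_schreierGraph_dist hS
      (fun q => F n (MulAction.ofQuotientStabilizer G (z n) q)) D ?_ x y
    intro s hs q
    rw [MulAction.ofQuotientStabilizer_smul, dist_eq_norm]
    exact (hC s n _).trans (hD s hs)
  · intro R
    obtain ⟨E, hE, h⟩ := hL R
    choose k hk using exists_schreierGraph_dist_smul_le.{u} hS
    obtain ⟨M, hM⟩ := (hE.image k).bddAbove
    refine ⟨M, fun n x y hxy => ?_⟩
    rw [dist_eq_norm] at hxy
    obtain ⟨g, hg, hgx⟩ := h n _ _ hxy
    rw [← MulAction.ofQuotientStabilizer_smul] at hgx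
    obtain rfl := MulAction.injective_ofQuotientStabilizer G (z n) hgx
    change (((schreierGraph S (G ⧸ MulAction.stabilizer G (z n))).dist x (g • x) : ℕ) : ℝ) ≤ M
    exact_mod_cast (hk g _ x).trans (hM ⟨g, hg, rfl⟩)

/-! ### Quotients of a group -/

/-- Embeddable quotients, in terms of the action of the group by left translations. -/
theorem QuotientsEmbed.exists_map {A : Type u} [Group A] {N : ℕ → Subgroup A}
    (h : QuotientsEmbed N) :
    ∃ (V : Type u) (_ : NormedAddCommGroup V) (_ : InnerProductSpace ℝ V) (_ : CompleteSpace V)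
      (f : (Σ n, A ⧸ N n) → V),
      (∀ a : A, ∃ C : ℝ, ∀ x, ‖f (a • x) - f x‖ ≤ C) ∧
      ∀ R : ℝ, ∃ E : Set A, E.Finite ∧
        ∀ x y, x.1 = y.1 → ‖f x - f y‖ ≤ R → ∃ a ∈ E, a • x = y := by
  obtain ⟨-, hN, ℓ, Y, mY, p, hp, V, i1, i2, i3, F, ρ₁, ρ₂, h₁, h₂, hF⟩ := h
  let _ := fun n => ℓ.quotientMetric (N n)
  let e : ∀ n, A ⧸ N n ≃ᵢ p ⁻¹' {n} := fun n => (hp.isometric n).some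
  -- The quotient metric is invariant under left translations, which may therefore move points far.
  -- Precomposing with inversion turns them into right translations, and `a` moves points by at most
  -- `ℓ a`.
  have he : ∀ n (x y : A ⧸ N n), dist (e n x⁻¹ : Y) (e n y⁻¹) = ℓ.quotientLen (N n) (x * y⁻¹) := by
    intro n x y
    rw [← Subtype.dist_eq, (e n).dist_eq]
    change ℓ.quotientLen (N n) (x⁻¹⁻¹ * y⁻¹) = _
    rw [inv_inv]
  refine ⟨V, i1, i2, i3, fun x => F (e x.1 x.2⁻¹), fun a => ⟨ρ₂ (ℓ.len a).toNNReal, ?_⟩, ?_⟩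
  · rintro ⟨n, x⟩
    change ‖F (e n (a • x)⁻¹) - F (e n x⁻¹)‖ ≤ _
    rw [← dist_eq_norm]
    refine le_trans (b := (ρ₂ (nndist (e n (a • x)⁻¹ : Y) (e n x⁻¹)) : ℝ)) ?_ ?_
    · exact_mod_cast (hF _ _).2
    · refine NNReal.coe_le_coe.2 (h₂.monotone ?_)
      rw [← NNReal.coe_le_coe, coe_nndist, he, Real.coe_toNNReal _ (ℓ.nonneg a)]
      have : a • x * x⁻¹ = (a : A ⧸ N n) := by
        obtain ⟨g, rfl⟩ := QuotientGroup.mk_surjective x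
        rw [MulAction.Quotient.smul_mk, smul_eq_mul, QuotientGroup.mk_mul, mul_inv_cancel_right]
      rw [this]
      exact ℓ.quotientLen_le _ _
  · intro R
    obtain ⟨t, ht⟩ := (h₁.tendsto.eventually_gt_atTop R.toNNReal).exists
    refine ⟨{a | ℓ.len a ≤ t}, ℓ.proper t, ?_⟩
    rintro ⟨n, x⟩ ⟨k, y⟩ hxy hR
    obtain rfl : n = k := hxy
    change ‖F (e n x⁻¹) - F (e n y⁻¹)‖ ≤ R at hR
    have h3 : ρ₁ (nndist (e n y⁻¹ : Y) (e n x⁻¹)) < ρ₁ t := by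
      refine lt_of_le_of_lt ((hF _ _).1.trans ?_) ht
      rw [nndist_comm, nndist_eq_nnnorm]
      exact NNReal.le_toNNReal_of_coe_le hR
    have h4 := h₁.monotone.reflect_lt h3
    obtain ⟨a, ha, hal⟩ := ℓ.exists_quotientLen_eq (N n) (y * x⁻¹)
    refine ⟨a, ?_, ?_⟩
    · rw [← NNReal.coe_lt_coe, coe_nndist, he] at h4
      exact hal.le.trans h4.le
    · have : a • x = y := by
        obtain ⟨g, rfl⟩ := QuotientGroup.mk_surjective x
        rw [MulAction.Quotient.smul_mk, smul_eq_mul, QuotientGroup.mk_mul, ha,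
          inv_mul_cancel_right]
      exact congrArg (Sigma.mk n) this

end CoarseUnion

namespace CoarseUnion

/-! ### Words of bounded length with prescribed pieces -/

/-- Letters of two kinds, grouped into pieces: the letters of kind `i` and index `n` form a piece
with the marked point `base i n`. -/
structure Alphabet (L : Type*) where
  kind : L → Bool
  index : L → ℕ
  base : Bool → ℕ → L
  kind_base : ∀ i n, kind (base i n) = i
  index_base : ∀ i n, index (base i n) = n

namespace Alphabet

variable {L : Type*} (𝒜 : Alphabet L)

/-- The permutations of the letters that preserve every piece. -/
def autGroup : Subgroup (Equiv.Perm L) where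
  carrier := {π | ∀ x, 𝒜.kind (π x) = 𝒜.kind x ∧ 𝒜.index (π x) = 𝒜.index x}
  mul_mem' := by
    intro π π' h h' x
    exact ⟨(h _).1.trans (h' x).1, (h _).2.trans (h' x).2⟩
  one_mem' := fun x => ⟨rfl, rfl⟩
  inv_mem' := by
    intro π h x
    have := h (π⁻¹ x)
    rw [Equiv.Perm.inv_def, π.apply_symm_apply] at this
    exact ⟨this.1.symm, this.2.symm⟩

/-- The word does not begin with a letter of kind `i`. -/
def Avoids (i : Bool) (u : List L) : Prop := ∀ y ∈ u.head?, 𝒜.kind y ≠ i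

/-- Reduced words of length at most `d`: the kinds alternate, a letter followed by `k` letters has
index `σ k`, and marked points are not allowed. -/
def IsWord (σ : ℕ → ℕ) (d : ℕ) : List L → Prop
  | [] => True
  | x :: u => u.length < d ∧ 𝒜.index x = σ u.length ∧ x ≠ 𝒜.base (𝒜.kind x) (σ u.length) ∧
      𝒜.Avoids (𝒜.kind x) u ∧ IsWord σ d u

theorem IsWord.tail {𝒜 : Alphabet L} {σ : ℕ → ℕ} {d : ℕ} {x : L} {u : List L}
    (h : 𝒜.IsWord σ d (x :: u)) : 𝒜.IsWord σ d u := h.2.2.2.2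

open Classical in
/-- Prepend a letter, unless it is a marked point. -/
noncomputable def push (σ : ℕ → ℕ) (x : L) (u : List L) : List L :=
  if x = 𝒜.base (𝒜.kind x) (σ u.length) then u else x :: u

/-- The first letter of kind `i`, which may be a marked point, and the rest of the word. -/
def split (σ : ℕ → ℕ) (i : Bool) : List L → L × List L
  | [] => (𝒜.base i (σ 0), [])
  | x :: u => if 𝒜.kind x = i then (x, u) else (𝒜.base i (σ (u.length + 1)), x :: u)

variable {𝒜} {σ : ℕ → ℕ} {d : ℕ} {i : Bool}

theorem split_of_avoids {u : List L} (h : 𝒜.Avoids i u) :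
    𝒜.split σ i u = (𝒜.base i (σ u.length), u) := by
  cases u with
  | nil => rfl
  | cons x u =>
    have : 𝒜.kind x ≠ i := h x rfl
    simp [split, this]

theorem push_base (i : Bool) (u : List L) : 𝒜.push σ (𝒜.base i (σ u.length)) u = u := by
  simp [push, kind_base]

theorem push_of_ne {x : L} {u : List L} (h : x ≠ 𝒜.base (𝒜.kind x) (σ u.length)) :
    𝒜.push σ x u = x :: u := if_neg h

/-- With `IsWord.exists_push`, this makes words correspond to pairs of a letter of kind `i`,
possibly marked, and a tail avoiding `i`. In these coordinates `move` just applies the permutation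
to the letter, so the action laws are immediate. -/
theorem split_push {x : L} {u : List L} (h : 𝒜.Avoids i u) (hx : 𝒜.kind x = i) :
    𝒜.split σ i (𝒜.push σ x u) = (x, u) := by
  subst hx
  by_cases hb : x = 𝒜.base (𝒜.kind x) (σ u.length)
  · rw [push, if_pos hb, split_of_avoids h, ← hb]
  · simp [push_of_ne hb, split]

theorem IsWord.push {x : L} {u : List L} (hu : 𝒜.IsWord σ d u) (hd : u.length < d)
    (hx : 𝒜.index x = σ u.length) (h : 𝒜.Avoids (𝒜.kind x) u) : 𝒜.IsWord σ d (𝒜.push σ x u) := by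
  by_cases hb : x = 𝒜.base (𝒜.kind x) (σ u.length)
  · rwa [Alphabet.push, if_pos hb]
  · rw [push_of_ne hb]
    exact ⟨hd, hx, hb, h, hu⟩

/-- Every word arises from its splitting. -/
theorem IsWord.exists_push {w : List L} (hw : 𝒜.IsWord σ d w) (i : Bool) :
    ∃ x u, 𝒜.IsWord σ d u ∧ 𝒜.Avoids i u ∧ 𝒜.kind x = i ∧ 𝒜.index x = σ u.length ∧
      𝒜.push σ x u = w := by
  by_cases h : 𝒜.Avoids i w
  · exact ⟨𝒜.base i (σ w.length), w, hw, h, 𝒜.kind_base _ _, 𝒜.index_base _ _, push_base i w⟩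
  · cases w with
    | nil => exact absurd (fun y hy => by simp at hy) h
    | cons x u =>
      have hx : 𝒜.kind x = i := by
        by_contra hne
        exact h fun y hy => by simp at hy; rwa [← hy]
      exact ⟨x, u, hw.tail, hx ▸ hw.2.2.2.1, hx, hw.2.1, push_of_ne hw.2.2.1⟩

/-! ### The action of letter permutations on words -/

variable (𝒜 σ d)

/-- Let a permutation act on the first letter of kind `i`, or trivially if there is no room. -/
noncomputable def move (i : Bool) (π : Equiv.Perm L) (w : List L) : List L :=
  if (𝒜.split σ i w).2.length < d then 𝒜.push σ (π (𝒜.split σ i w).1) (𝒜.split σ i w).2 else w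

variable {𝒜 σ d}

theorem move_push {x : L} {u : List L} (h : 𝒜.Avoids i u) (hx : 𝒜.kind x = i)
    (hd : u.length < d) (π : Equiv.Perm L) :
    𝒜.move σ d i π (𝒜.push σ x u) = 𝒜.push σ (π x) u := by
  rw [move, split_push h hx, if_pos hd]

theorem move_of_le {x : L} {u : List L} (h : 𝒜.Avoids i u) (hx : 𝒜.kind x = i)
    (hd : d ≤ u.length) (π : Equiv.Perm L) :
    𝒜.move σ d i π (𝒜.push σ x u) = 𝒜.push σ x u := by
  rw [move, split_push h hx, if_neg hd.not_gt]

theorem IsWord.move {w : List L} (hw : 𝒜.IsWord σ d w) {π : Equiv.Perm L} (hπ : π ∈ 𝒜.autGroup) :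
    𝒜.IsWord σ d (𝒜.move σ d i π w) := by
  obtain ⟨x, u, hu, ha, hk, hi, rfl⟩ := hw.exists_push i
  by_cases hd : u.length < d
  · rw [move_push ha hk hd]
    exact hu.push hd ((hπ x).2.trans hi) (by rwa [(hπ x).1, hk])
  · rwa [move_of_le ha hk (not_lt.1 hd)]

theorem IsWord.move_one {w : List L} (hw : 𝒜.IsWord σ d w) : 𝒜.move σ d i 1 w = w := by
  obtain ⟨x, u, hu, ha, hk, hi, rfl⟩ := hw.exists_push i
  by_cases hd : u.length < d
  · rw [move_push ha hk hd, Equiv.Perm.one_apply]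
  · rw [move_of_le ha hk (not_lt.1 hd)]

theorem IsWord.move_mul {w : List L} (hw : 𝒜.IsWord σ d w) (π : Equiv.Perm L) {π' : Equiv.Perm L}
    (hπ : π' ∈ 𝒜.autGroup) :
    𝒜.move σ d i (π * π') w = 𝒜.move σ d i π (𝒜.move σ d i π' w) := by
  obtain ⟨x, u, hu, ha, hk, hi, rfl⟩ := hw.exists_push i
  by_cases hd : u.length < d
  · rw [move_push ha hk hd, move_push ha hk hd, move_push ha ((hπ x).1.trans hk) hd,
      Equiv.Perm.mul_apply]
  · rw [move_of_le ha hk (not_lt.1 hd), move_of_le ha hk (not_lt.1 hd),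
      move_of_le ha hk (not_lt.1 hd)]

variable (𝒜 σ d)

/-- The set of reduced words. -/
abbrev Words : Type _ := {w : List L // 𝒜.IsWord σ d w}

/-- The empty word. -/
def root : 𝒜.Words σ d := ⟨[], trivial⟩

/-- The action on words through the first letter of kind `i`. -/
noncomputable def wordHom (i : Bool) : 𝒜.autGroup →* Equiv.Perm (𝒜.Words σ d) :=
  let _ : MulAction 𝒜.autGroup (𝒜.Words σ d) :=
    { smul := fun π w => ⟨𝒜.move σ d i π w.1, w.2.move π.2⟩
      one_smul := fun w => Subtype.ext w.2.move_one
      mul_smul := fun π π' w => Subtype.ext (w.2.move_mul π π'.2) }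
  MulAction.toPermHom _ _

variable {𝒜 σ d}

theorem wordHom_apply_val (π : 𝒜.autGroup) (w : 𝒜.Words σ d) :
    (𝒜.wordHom σ d i π w).1 = 𝒜.move σ d i π w.1 := rfl

theorem wordHom_cons {x y : L} {u : List L} (hx : 𝒜.IsWord σ d (x :: u))
    (hy : 𝒜.IsWord σ d (y :: u)) {π : 𝒜.autGroup} (h : π.1 x = y) (hk : 𝒜.kind x = i) :
    𝒜.wordHom σ d i π ⟨x :: u, hx⟩ = ⟨y :: u, hy⟩ := by
  refine Subtype.ext ?_
  rw [wordHom_apply_val]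
  change 𝒜.move σ d i π (x :: u) = y :: u
  rw [← push_of_ne hx.2.2.1, move_push (hk ▸ hx.2.2.2.1) hk hx.1, h, push_of_ne hy.2.2.1]

theorem wordHom_tail {x : L} {u : List L} (hx : 𝒜.IsWord σ d (x :: u))
    {π : 𝒜.autGroup} (h : π.1 (𝒜.base i (σ u.length)) = x) (hk : 𝒜.kind x = i) :
    𝒜.wordHom σ d i π ⟨u, hx.tail⟩ = ⟨x :: u, hx⟩ := by
  refine Subtype.ext ?_
  rw [wordHom_apply_val]
  change 𝒜.move σ d i π u = x :: u
  conv_lhs => rw [← push_base (𝒜 := 𝒜) (σ := σ) i u]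
  rw [move_push (hk ▸ hx.2.2.2.1) (𝒜.kind_base _ _) hx.1, h, push_of_ne hx.2.2.1]

/-- Only the pieces of index `σ 0, …, σ (d - 1)` supply letters, and lengths are at most `d`. -/
theorem finite_words (h : ∀ n, {x | 𝒜.index x = n}.Finite) : Finite (𝒜.Words σ d) := by
  have hl : (⋃ k ∈ Set.Iio d, {x | 𝒜.index x = σ k}).Finite :=
    (Set.finite_Iio d).biUnion fun k _ => h _
  have key : ∀ k, {w | 𝒜.IsWord σ d w ∧ w.length ≤ k}.Finite := by
    intro k
    induction k with
    | zero =>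
      refine (Set.finite_singleton []).subset ?_
      rintro w ⟨-, hw⟩
      exact List.length_eq_zero_iff.1 (Nat.le_zero.1 hw)
    | succ k ih =>
      refine ((Set.finite_singleton []).union (hl.image2 List.cons ih)).subset ?_
      rintro (_ | ⟨x, u⟩) ⟨hw, hk⟩
      · exact Or.inl rfl
      · refine Or.inr ⟨x, ?_, u, ⟨hw.tail, by simpa using hk⟩, rfl⟩
        exact Set.mem_biUnion (show u.length ∈ Set.Iio d from hw.1) hw.2.1
  refine ((key d).subset ?_).to_subtype
  rintro (_ | ⟨x, u⟩) hw
  · exact ⟨hw, Nat.zero_le _⟩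
  · exact ⟨hw, hw.1⟩

/-! ### The Hilbert space map -/

section WordMap

variable {V : Type*} [NormedAddCommGroup V]

open Classical in
/-- Every letter of a word contributes its displacement from the marked point, in a coordinate of
its own piece. -/
noncomputable def wordMap (𝒜 : Alphabet L) (f : L → V) :
    List L → lp (fun _ : List L × Bool => V) 2
  | [] => 0
  | x :: u => wordMap 𝒜 f u +
      lp.single 2 (u, 𝒜.kind x) (f x - f (𝒜.base (𝒜.kind x) (𝒜.index x)))

variable (f : L → V)

open Classical in
-- A marked letter has zero displacement, so dropping it does not affect the formula.
theorem wordMap_push {x : L} {u : List L} (hx : 𝒜.index x = σ u.length) :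
    𝒜.wordMap f (𝒜.push σ x u) = 𝒜.wordMap f u +
      lp.single 2 (u, 𝒜.kind x) (f x - f (𝒜.base (𝒜.kind x) (𝒜.index x))) := by
  by_cases hb : x = 𝒜.base (𝒜.kind x) (σ u.length)
  · rw [push, if_pos hb, hx, ← hb, sub_self, lp.single_zero, add_zero]
  · rw [push_of_ne hb, wordMap]

/-- The coordinates used by `w` are labelled by its proper tails, all strictly shorter than `w`. -/
theorem wordMap_apply_of_length_le {w u : List L} (h : w.length ≤ u.length) (i : Bool) :
    𝒜.wordMap f w (u, i) = 0 := by
  classical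
  induction w with
  | nil => rfl
  | cons x w ih =>
    have hne : (u, i) ≠ (w, 𝒜.kind x) := by
      rintro h'
      rw [(Prod.mk.inj h').1] at h
      simp at h
    rw [wordMap, lp.coeFn_add, Pi.add_apply, ih (by simp at h; omega), lp.single_apply,
      Pi.single_eq_of_ne hne, add_zero]

/-- Only the coordinate of the moved letter changes. Its marked point is unchanged because the
permutation preserves pieces, so the two base terms cancel. -/
theorem norm_wordMap_move_sub_le {w : List L} (hw : 𝒜.IsWord σ d w) {π : Equiv.Perm L}
    (hπ : π ∈ 𝒜.autGroup) {C : ℝ} (hC : ∀ x, ‖f (π x) - f x‖ ≤ C) :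
    ‖𝒜.wordMap f (𝒜.move σ d i π w) - 𝒜.wordMap f w‖ ≤ C := by
  classical
  obtain ⟨x, u, hu, ha, hk, hi, rfl⟩ := hw.exists_push i
  by_cases hd : u.length < d
  · rw [move_push ha hk hd, wordMap_push f hi, wordMap_push f ((hπ x).2.trans hi), (hπ x).1,
      (hπ x).2, add_sub_add_left_eq_sub, ← lp.single_sub, sub_sub_sub_cancel_right,
      lp.norm_single two_pos]
    exact hC x
  · rw [move_of_le ha hk (not_lt.1 hd), sub_self, norm_zero]
    exact (norm_nonneg _).trans (hC x)

/-- This is the dichotomy for comparing `x :: u` with a word that is no longer: either the first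
letter is orthogonal to everything in `w`, or the two words differ only in that letter. -/
theorem wordMap_apply_eq_zero_or {x : L} {u w : List L} (h : w.length ≤ (x :: u).length) :
    𝒜.wordMap f w (u, 𝒜.kind x) = 0 ∨ ∃ y, w = y :: u ∧ 𝒜.kind y = 𝒜.kind x := by
  classical
  cases w with
  | nil => exact Or.inl rfl
  | cons y v =>
    by_cases hc : (u, 𝒜.kind x) = (v, 𝒜.kind y)
    · obtain ⟨rfl, hk⟩ := Prod.mk.inj hc
      exact Or.inr ⟨y, rfl, hk.symm⟩
    · left
      rw [wordMap, lp.coeFn_add, Pi.add_apply, lp.single_apply, Pi.single_eq_of_ne hc, add_zero,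
        wordMap_apply_of_length_le f (by simpa using h)]

variable [InnerProductSpace ℝ V]

/-- Removing the first letter of one of two words, in a coordinate which does not matter for the
other word. -/
theorem norm_wordMap_cons_sub_sq {x : L} {u w : List L}
    (h : 𝒜.wordMap f w (u, 𝒜.kind x) = 0) :
    ‖𝒜.wordMap f (x :: u) - 𝒜.wordMap f w‖ ^ 2 = ‖𝒜.wordMap f u - 𝒜.wordMap f w‖ ^ 2 +
      ‖f x - f (𝒜.base (𝒜.kind x) (𝒜.index x))‖ ^ 2 := by
  classical
  have h0 : (𝒜.wordMap f u - 𝒜.wordMap f w) (u, 𝒜.kind x) = 0 := by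
    rw [lp.coeFn_sub, Pi.sub_apply, h, wordMap_apply_of_length_le f le_rfl, sub_zero]
  rw [wordMap, add_sub_right_comm, norm_add_sq_real, lp.inner_single_right, h0, inner_zero_left,
    lp.norm_single two_pos]
  ring

variable {f}

open Pointwise in
/-- Words with close images differ by one of finitely many group elements, if this is true of the
letters of each piece. -/
theorem exists_finite_wordMap {G I : Type*} [Group G] {σ : I → ℕ → ℕ} {d : I → ℕ}
    (Φ : ∀ n, G →* Equiv.Perm (𝒜.Words (σ n) (d n)))
    (hsep : ∀ x y, x ≠ y → 1 ≤ ‖f x - f y‖)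
    (hL : ∀ R : ℝ, ∃ E : Set G, E.Finite ∧ ∀ x y, 𝒜.kind x = 𝒜.kind y → 𝒜.index x = 𝒜.index y →
      ‖f x - f y‖ ≤ R → ∃ g ∈ E, ∃ π : 𝒜.autGroup, π.1 x = y ∧
        ∀ n, Φ n g = 𝒜.wordHom (σ n) (d n) (𝒜.kind x) π) (R : ℝ) :
    ∃ E : Set G, E.Finite ∧ ∀ n (w w' : 𝒜.Words (σ n) (d n)),
      ‖𝒜.wordMap f w.1 - 𝒜.wordMap f w'.1‖ ≤ R → ∃ g ∈ E, Φ n g w = w' := by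
  classical
  obtain ⟨E₀, hE₀, h₀⟩ := hL R
  -- Induction on a bound for the squared distance. The bound by `R` is kept alongside so that the
  -- same finite set `E₀` handles the letters at every stage.
  have key : ∀ k : ℕ, ∃ E : Set G, E.Finite ∧ ∀ n (w w' : 𝒜.Words (σ n) (d n)),
      ‖𝒜.wordMap f w.1 - 𝒜.wordMap f w'.1‖ ≤ R → ‖𝒜.wordMap f w.1 - 𝒜.wordMap f w'.1‖ ^ 2 < k →
      ∃ g ∈ E, Φ n g w = w' := by
    intro k
    induction k with
    | zero =>
      refine ⟨∅, Set.finite_empty, fun n w w' _ h => ?_⟩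
      rw [Nat.cast_zero] at h
      exact absurd h (not_lt.2 (sq_nonneg _))
    | succ k ih =>
      obtain ⟨E, hE, h⟩ := ih
      have longer : ∀ n (w w' : 𝒜.Words (σ n) (d n)), w'.1.length ≤ w.1.length →
          ‖𝒜.wordMap f w.1 - 𝒜.wordMap f w'.1‖ ≤ R →
          ‖𝒜.wordMap f w.1 - 𝒜.wordMap f w'.1‖ ^ 2 < (k + 1 : ℕ) →
          ∃ g ∈ {1} ∪ E₀ ∪ E * E₀⁻¹, Φ n g w = w' := by
        rintro n ⟨w, hw⟩ ⟨w', hw'⟩ hlen hR hk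
        dsimp only at hlen hR hk
        cases w with
        | nil =>
          obtain rfl : w' = [] := List.length_eq_zero_iff.1 (Nat.le_zero.1 hlen)
          exact ⟨1, by simp, by rw [map_one, Equiv.Perm.one_apply]⟩
        | cons x u =>
          rcases wordMap_apply_eq_zero_or (𝒜 := 𝒜) f hlen with hz | ⟨y, rfl, hy⟩
          · have hsq := norm_wordMap_cons_sub_sq f hz
            -- An unmarked letter is at distance at least 1 from its marked point; by orthogonality,
            -- removing it lowers the squared distance by at least 1.
            have h1 : 1 ≤ ‖f x - f (𝒜.base (𝒜.kind x) (𝒜.index x))‖ := by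
              refine hsep _ _ ?_
              rw [hw.2.1]
              exact hw.2.2.1
            have h2 : ‖f (𝒜.base (𝒜.kind x) (𝒜.index x)) - f x‖ ≤ R := by
              rw [norm_sub_rev]
              refine (abs_le_of_sq_le_sq' ?_ (norm_nonneg _)).2.trans hR
              rw [hsq]
              exact le_add_of_nonneg_left (sq_nonneg _)
            have h3 : ‖𝒜.wordMap f u - 𝒜.wordMap f w'‖ ≤ R := by
              refine (abs_le_of_sq_le_sq' ?_ (norm_nonneg _)).2.trans hR
              rw [hsq]
              exact le_add_of_nonneg_right (sq_nonneg _)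
            have h4 : ‖𝒜.wordMap f u - 𝒜.wordMap f w'‖ ^ 2 < k := by
              push_cast at hk
              nlinarith
            obtain ⟨g, hg, hgw⟩ := h n ⟨u, hw.tail⟩ ⟨w', hw'⟩ h3 h4
            obtain ⟨a, ha, π, hπ, hΦ⟩ := h₀ _ _ (𝒜.kind_base _ _) (𝒜.index_base _ _) h2
            rw [𝒜.kind_base] at hΦ
            rw [hw.2.1] at hπ
            have h5 := wordHom_tail hw hπ rfl
            rw [← hΦ n] at h5
            -- `a` creates the letter `x` on top of `u`, and `g` takes `u` to `w'`.
            refine ⟨g * a⁻¹, Or.inr (Set.mul_mem_mul hg (Set.inv_mem_inv.2 ha)), ?_⟩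
            rw [map_mul, map_inv, Equiv.Perm.mul_apply, ← h5, Equiv.Perm.inv_def, Equiv.symm_apply_apply, hgw]
          · have h1 : ‖f x - f y‖ ≤ R := by
              have hi : 𝒜.index y = 𝒜.index x := hw'.2.1.trans hw.2.1.symm
              have := hR
              rw [wordMap, wordMap, hy, hi, add_sub_add_left_eq_sub, ← lp.single_sub,
                sub_sub_sub_cancel_right, lp.norm_single two_pos] at this
              exact this
            obtain ⟨a, ha, π, hπ, hΦ⟩ := h₀ x y hy.symm (hw.2.1.trans hw'.2.1.symm) h1
            refine ⟨a, Or.inl (Or.inr ha), ?_⟩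
            rw [hΦ n]
            exact wordHom_cons hw hw' hπ rfl
      -- Inverses cover the case where the second word is the longer one.
      refine ⟨({1} ∪ E₀ ∪ E * E₀⁻¹) ∪ ({1} ∪ E₀ ∪ E * E₀⁻¹)⁻¹, ?_, fun n w w' hR hk => ?_⟩
      · have : ({1} ∪ E₀ ∪ E * E₀⁻¹).Finite :=
          ((Set.finite_singleton _).union hE₀).union (hE.mul hE₀.inv)
        exact this.union this.inv
      · rcases le_total w'.1.length w.1.length with hlen | hlen
        · obtain ⟨g, hg, hgw⟩ := longer n w w' hlen hR hk
          exact ⟨g, Or.inl hg, hgw⟩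
        · rw [norm_sub_rev] at hR hk
          obtain ⟨g, hg, hgw⟩ := longer n w' w hlen hR hk
          refine ⟨g⁻¹, Or.inr (Set.inv_mem_inv.2 hg), ?_⟩
          rw [map_inv, ← hgw, Equiv.Perm.inv_def, Equiv.symm_apply_apply]
  obtain ⟨k, hk⟩ := exists_nat_gt (R ^ 2)
  obtain ⟨E, hE, h⟩ := key k
  refine ⟨E, hE, fun n w w' hR => h n w w' hR (lt_of_le_of_lt ?_ hk)⟩
  exact pow_le_pow_left₀ (norm_nonneg _) hR 2

end WordMap

end Alphabet

end CoarseUnion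

namespace CoarseUnion

/-! ### Free products -/

section Alternating

variable {A B : Type*}

/-- Sequences of elements of two types, taken alternately; the element which is followed by
`k` others satisfies `P k`. -/
def Alternating (P : ℕ → A ⊕ B → Prop) : List (A ⊕ B) → Prop
  | [] => True
  | s :: l => P l.length s ∧ (∀ t ∈ l.head?, t.isRight ≠ s.isRight) ∧ Alternating P l

theorem Alternating.mono {P Q : ℕ → A ⊕ B → Prop} {l : List (A ⊕ B)} (h : Alternating P l)
    (hPQ : ∀ k < l.length, ∀ s, P k s → Q k s) : Alternating Q l := by
  induction l with
  | nil => trivial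
  | cons s l ih =>
    exact ⟨hPQ _ (by simp) _ h.1, h.2.1,
      ih h.2.2 fun k hk => hPQ k (hk.trans (by simp))⟩

end Alternating

section FreeProduct

variable {A : Type u} {B : Type v} [Group A] [Group B] (N : ℕ → Subgroup A) (M : ℕ → Subgroup B)

/-- The alphabet whose pieces are the coset spaces of the `N n` and the `M n`. -/
def cosetAlphabet : Alphabet ((Σ n, A ⧸ N n) ⊕ (Σ n, B ⧸ M n)) where
  kind := Sum.isRight
  index := Sum.elim Sigma.fst Sigma.fst
  base i n := bif i then Sum.inr ⟨n, ((1 : B) : B ⧸ M n)⟩ else Sum.inl ⟨n, ((1 : A) : A ⧸ N n)⟩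
  kind_base := by rintro (_ | _) n <;> rfl
  index_base := by rintro (_ | _) n <;> rfl

/-- The action of the first factor on the letters. -/
def leftHom : A →* (cosetAlphabet N M).autGroup :=
  MonoidHom.codRestrict ((Equiv.Perm.sumCongrHom _ _).comp
      ((MonoidHom.inl _ _).comp (MulAction.toPermHom A (Σ n, A ⧸ N n)))) _ <| by
    rintro a (x | x) <;> exact ⟨rfl, rfl⟩

/-- The action of the second factor on the letters. -/
def rightHom : B →* (cosetAlphabet N M).autGroup :=
  MonoidHom.codRestrict ((Equiv.Perm.sumCongrHom _ _).comp
      ((MonoidHom.inr _ _).comp (MulAction.toPermHom B (Σ n, B ⧸ M n)))) _ <| by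
    rintro b (x | x) <;> exact ⟨rfl, rfl⟩

theorem leftHom_inl (a : A) (x : Σ n, A ⧸ N n) :
    (leftHom N M a).1 (Sum.inl x) = Sum.inl (a • x) := rfl

theorem leftHom_inr (a : A) (x : Σ n, B ⧸ M n) :
    (leftHom N M a).1 (Sum.inr x) = Sum.inr x := rfl

theorem rightHom_inl (b : B) (x : Σ n, A ⧸ N n) :
    (rightHom N M b).1 (Sum.inl x) = Sum.inl x := rfl

theorem rightHom_inr (b : B) (x : Σ n, B ⧸ M n) :
    (rightHom N M b).1 (Sum.inr x) = Sum.inr (b • x) := rfl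

variable (σ : ℕ → ℕ) (d : ℕ)

/-- The action of the free product on the words. -/
noncomputable def wordAction :
    Monoid.Coprod A B →* Equiv.Perm ((cosetAlphabet N M).Words σ d) :=
  Monoid.Coprod.lift (((cosetAlphabet N M).wordHom σ d false).comp (leftHom N M))
    (((cosetAlphabet N M).wordHom σ d true).comp (rightHom N M))

theorem wordAction_inl (a : A) : wordAction N M σ d (Monoid.Coprod.inl a) =
    (cosetAlphabet N M).wordHom σ d false (leftHom N M a) :=
  Monoid.Coprod.lift_apply_inl _ _ _

theorem wordAction_inr (b : B) : wordAction N M σ d (Monoid.Coprod.inr b) =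
    (cosetAlphabet N M).wordHom σ d true (rightHom N M b) :=
  Monoid.Coprod.lift_apply_inr _ _ _

/-- The stabilizer of the empty word. -/
noncomputable def wordStabilizer : Subgroup (Monoid.Coprod A B) :=
  let _ := MulAction.compHom ((cosetAlphabet N M).Words σ d) (wordAction N M σ d)
  MulAction.stabilizer (Monoid.Coprod A B) ((cosetAlphabet N M).root σ d)

theorem mem_wordStabilizer {g : Monoid.Coprod A B} : g ∈ wordStabilizer N M σ d ↔
    wordAction N M σ d g ((cosetAlphabet N M).root σ d) = (cosetAlphabet N M).root σ d :=
  Iff.rfl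

variable {N M}

theorem finite_index_fibre (hN : ∀ n, (N n).FiniteIndex) (hM : ∀ n, (M n).FiniteIndex) (n : ℕ) :
    {x | (cosetAlphabet N M).index x = n}.Finite := by
  have hA := hN n
  have hB := hM n
  refine ((Set.finite_range fun x : A ⧸ N n => Sum.inl ⟨n, x⟩).union
    (Set.finite_range fun x : B ⧸ M n => Sum.inr ⟨n, x⟩)).subset ?_
  rintro (⟨k, x⟩ | ⟨k, x⟩) h
  · obtain rfl : k = n := h
    exact Or.inl ⟨x, rfl⟩
  · obtain rfl : k = n := h
    exact Or.inr ⟨x, rfl⟩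

theorem finiteIndex_wordStabilizer (hN : ∀ n, (N n).FiniteIndex) (hM : ∀ n, (M n).FiniteIndex) :
    (wordStabilizer N M σ d).FiniteIndex := by
  let _ := MulAction.compHom ((cosetAlphabet N M).Words σ d) (wordAction N M σ d)
  have := Alphabet.finite_words (σ := σ) (d := d) (finite_index_fibre hN hM)
  have : Finite (Monoid.Coprod A B ⧸ wordStabilizer N M σ d) :=
    Finite.of_injective _ (MulAction.injective_ofQuotientStabilizer (Monoid.Coprod A B)
      ((cosetAlphabet N M).root σ d))
  exact Subgroup.finiteIndex_of_finite_quotient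

/-! ### Normal forms -/

/-- The element is not the identity. -/
def Nontriv (s : A ⊕ B) : Prop := Sum.elim (· ≠ 1) (· ≠ 1) s

/-- The product in the free product of a sequence of elements of the factors. -/
def sylProd (l : List (A ⊕ B)) : Monoid.Coprod A B :=
  (l.map (Sum.elim Monoid.Coprod.inl Monoid.Coprod.inr)).prod

theorem sylProd_cons (s : A ⊕ B) (l : List (A ⊕ B)) :
    sylProd (s :: l) = Sum.elim Monoid.Coprod.inl Monoid.Coprod.inr s * sylProd l :=
  List.prod_cons

/-- Prepend a syllable, merging it with a first syllable from the same factor and deleting the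
result if it is trivial. Only existence of the form matters here, not uniqueness. -/
theorem exists_alternating (g : Monoid.Coprod A B) :
    ∃ l : List (A ⊕ B), Alternating (fun _ => Nontriv) l ∧ sylProd l = g := by
  induction g using Monoid.Coprod.induction_on' with
  | one => exact ⟨[], trivial, rfl⟩
  | inl_mul a g ih =>
    obtain ⟨l, hl, rfl⟩ := ih
    by_cases ha : a = 1
    · exact ⟨l, hl, by rw [ha, map_one, one_mul]⟩
    rcases l with _ | ⟨a' | b', l⟩
    · exact ⟨[Sum.inl a], ⟨ha, by simp, trivial⟩, sylProd_cons _ _⟩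
    · by_cases h1 : a * a' = 1
      · refine ⟨l, hl.2.2, ?_⟩
        rw [sylProd_cons, Sum.elim_inl, ← mul_assoc, ← map_mul, h1, map_one, one_mul]
      · refine ⟨Sum.inl (a * a') :: l, ⟨h1, hl.2.1, hl.2.2⟩, ?_⟩
        rw [sylProd_cons, sylProd_cons, Sum.elim_inl, Sum.elim_inl, map_mul, mul_assoc]
    · exact ⟨Sum.inl a :: Sum.inr b' :: l, ⟨ha, by simp, hl⟩, sylProd_cons _ _⟩
  | inr_mul b g ih =>
    obtain ⟨l, hl, rfl⟩ := ih
    by_cases hb : b = 1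
    · exact ⟨l, hl, by rw [hb, map_one, one_mul]⟩
    rcases l with _ | ⟨a' | b', l⟩
    · exact ⟨[Sum.inr b], ⟨hb, by simp, trivial⟩, sylProd_cons _ _⟩
    · exact ⟨Sum.inr b :: Sum.inl a' :: l, ⟨hb, by simp, hl⟩, sylProd_cons _ _⟩
    · by_cases h1 : b * b' = 1
      · refine ⟨l, hl.2.2, ?_⟩
        rw [sylProd_cons, Sum.elim_inr, ← mul_assoc, ← map_mul, h1, map_one, one_mul]
      · refine ⟨Sum.inr (b * b') :: l, ⟨h1, hl.2.1, hl.2.2⟩, ?_⟩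
        rw [sylProd_cons, sylProd_cons, Sum.elim_inr, Sum.elim_inr, map_mul, mul_assoc]

variable (N M) in
/-- The element is outside the subgroup of index `n` of its group. -/
def Outside (n : ℕ) (s : A ⊕ B) : Prop := Sum.elim (· ∉ N n) (· ∉ M n) s

/-- The missing letter counts as the marked point; once moved off it, it becomes a genuine new
letter. -/
theorem wordHom_of_base_ne {L : Type*} {𝒜 : Alphabet L} {σ : ℕ → ℕ} {d : ℕ} {i : Bool}
    (π : 𝒜.autGroup) (w : 𝒜.Words σ d) (hw : 𝒜.Avoids i w.1) (hd : w.1.length < d)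
    (hb : π.1 (𝒜.base i (σ w.1.length)) ≠ 𝒜.base i (σ w.1.length)) :
    (𝒜.wordHom σ d i π w).1 = π.1 (𝒜.base i (σ w.1.length)) :: w.1 := by
  rw [Alphabet.wordHom_apply_val]
  conv_lhs => rw [← Alphabet.push_base (𝒜 := 𝒜) (σ := σ) i w.1]
  rw [Alphabet.move_push hw (𝒜.kind_base _ _) hd, Alphabet.push_of_ne]
  rwa [(π.2 _).1, 𝒜.kind_base]

/-- Recording only the kinds suffices for the induction: they give the length, hence the room and
the index of the next piece, and show that the next syllable meets a word avoiding its kind. -/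
theorem map_kind_wordAction {l : List (A ⊕ B)}
    (hl : Alternating (fun k => Outside N M (σ k)) l) (hd : l.length ≤ d) :
    (wordAction N M σ d (sylProd l) ((cosetAlphabet N M).root σ d)).1.map
      (cosetAlphabet N M).kind = l.map Sum.isRight := by
  induction l with
  | nil => simp [sylProd, Alphabet.root]
  | cons s l ih =>
    have hw := ih hl.2.2 ((Nat.le_succ _).trans hd)
    rw [sylProd_cons, map_mul, Equiv.Perm.mul_apply]
    set w := wordAction N M σ d (sylProd l) ((cosetAlphabet N M).root σ d)
    have hlen : w.1.length = l.length := by simpa using congrArg List.length hw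
    have hav : (cosetAlphabet N M).Avoids s.isRight w.1 := by
      intro y hy
      have h1 := congrArg List.head? hw
      rw [List.head?_map, List.head?_map, Option.mem_def.1 hy, Option.map_some] at h1
      obtain ⟨t, ht, hty⟩ := Option.map_eq_some_iff.1 h1.symm
      rw [← hty]
      exact hl.2.1 t ht
    have hlt : w.1.length < d := hlen ▸ hd
    have hs : Outside N M (σ w.1.length) s := hlen ▸ hl.1
    rcases s with a | b
    · rw [Sum.elim_inl, wordAction_inl, wordHom_of_base_ne (i := false) _ _ hav hlt, List.map_cons, hw]
      · rfl
      · intro h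
        have h2 := Sum.inl_injective h
        have h3 := eq_of_heq (Sigma.mk.inj h2).2
        refine hs (?_ : a ∈ N (σ w.1.length))
        have h4 : ((a * 1 : A) : A ⧸ N (σ w.1.length)) = ((1 : A) : A ⧸ N (σ w.1.length)) := h3
        rwa [mul_one, eq_comm, QuotientGroup.eq, inv_one, one_mul] at h4
    · rw [Sum.elim_inr, wordAction_inr, wordHom_of_base_ne (i := true) _ _ hav hlt, List.map_cons, hw]
      · rfl
      · intro h
        have h2 := Sum.inr_injective h
        have h3 := eq_of_heq (Sigma.mk.inj h2).2
        refine hs (?_ : b ∈ M (σ w.1.length))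
        have h4 : ((b * 1 : B) : B ⧸ M (σ w.1.length)) = ((1 : B) : B ⧸ M (σ w.1.length)) := h3
        rwa [mul_one, eq_comm, QuotientGroup.eq, inv_one, one_mul] at h4

/-! ### Separating elements by the stabilizers -/

variable {σ d}

theorem sylProd_notMem_wordStabilizer {l : List (A ⊕ B)} (hne : l ≠ [])
    (hl : Alternating (fun k => Outside N M (σ k)) l) (hd : l.length ≤ d) :
    sylProd l ∉ wordStabilizer N M σ d := by
  intro h
  have h1 := map_kind_wordAction σ d hl hd
  rw [(mem_wordStabilizer N M σ d).1 h] at h1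
  exact hne (List.map_eq_nil_iff.1 h1.symm)

/-- The subgroups have trivial intersection if the pieces are chosen in all possible ways. -/
theorem iInf_wordStabilizer (hN : ⨅ n, N n = ⊥) (hM : ⨅ n, M n = ⊥) {τ : ℕ → List ℕ}
    (hτ : Function.Surjective τ) :
    ⨅ n, wordStabilizer N M (fun k => (τ n).getD k 0) (τ n).length = ⊥ := by
  have hout : ∀ s : A ⊕ B, Nontriv s → ∃ n, Outside N M n s := by
    rintro (a | b) hs
    · by_contra! h
      have h1 : a ∈ ⨅ n, N n := Subgroup.mem_iInf.2 fun n => not_not.1 (h n)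
      rw [hN] at h1
      exact hs h1
    · by_contra! h
      have h1 : b ∈ ⨅ n, M n := Subgroup.mem_iInf.2 fun n => not_not.1 (h n)
      rw [hM] at h1
      exact hs h1
  have key : ∀ l : List (A ⊕ B), Alternating (fun _ => Nontriv) l → ∃ q : List ℕ,
      q.length = l.length ∧ Alternating (fun k => Outside N M (q.getD k 0)) l := by
    intro l
    induction l with
    | nil => exact fun _ => ⟨[], rfl, trivial⟩
    | cons s l ih =>
      intro hl
      obtain ⟨q, hq, h⟩ := ih hl.2.2
      obtain ⟨n, hn⟩ := hout s hl.1
      -- The new syllable is followed by `l.length = q.length` others, so its index belongs at the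
      -- end of the list, leaving earlier positions untouched.
      refine ⟨q ++ [n], by simp [hq], ?_, hl.2.1, h.mono fun k hk t ht => ?_⟩
      · rw [← hq]
        simpa using hn
      · rw [List.getD_append _ _ _ _ (hq ▸ hk)]
        exact ht
  refine (Subgroup.eq_bot_iff_forall _).2 fun g hg => ?_
  obtain ⟨l, hl, rfl⟩ := exists_alternating g
  rcases eq_or_ne l [] with rfl | hne
  · rfl
  · obtain ⟨q, hq, h⟩ := key l hl
    obtain ⟨n, rfl⟩ := hτ q
    exact absurd (Subgroup.mem_iInf.1 hg n) (sylProd_notMem_wordStabilizer hne h hq.ge)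

theorem eventually_notMem_wordStabilizer (hN : ∀ a ≠ 1, ∀ᶠ n in atTop, a ∉ N n)
    (hM : ∀ b ≠ 1, ∀ᶠ n in atTop, b ∉ M n) {g : Monoid.Coprod A B} (hg : g ≠ 1) :
    ∀ᶠ n in atTop, g ∉ wordStabilizer N M (fun _ => n) n := by
  have key : ∀ l : List (A ⊕ B), Alternating (fun _ => Nontriv) l →
      ∀ᶠ n in atTop, Alternating (fun _ => Outside N M n) l := by
    intro l
    induction l with
    | nil => exact fun _ => Eventually.of_forall fun _ => trivial
    | cons s l ih =>
      intro hl
      have hs : ∀ᶠ n in atTop, Outside N M n s := by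
        rcases s with a | b
        · exact hN a hl.1
        · exact hM b hl.1
      filter_upwards [ih hl.2.2, hs] with n h1 h2
      exact ⟨h2, hl.2.1, h1⟩
  obtain ⟨l, hl, rfl⟩ := exists_alternating g
  have hne : l ≠ [] := by
    rintro rfl
    exact hg rfl
  -- The maximal word length is `n` too, so `n ≥ l.length` leaves room for every syllable.
  filter_upwards [key l hl, eventually_ge_atTop l.length] with n h1 h2
  exact sylProd_notMem_wordStabilizer hne h1 h2

end FreeProduct

/-! ### The embedding -/

/-- A map to a Hilbert space can be changed by a bounded amount so as to separate points. -/
theorem exists_separated_map {L W : Type u} [NormedAddCommGroup W] [InnerProductSpace ℝ W]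
    [CompleteSpace W] (g : L → W) :
    ∃ (V : Type u) (_ : NormedAddCommGroup V) (_ : InnerProductSpace ℝ V) (_ : CompleteSpace V)
      (f : L → V), (∀ x y, x ≠ y → 1 ≤ ‖f x - f y‖) ∧ (∀ x y, ‖g x - g y‖ ≤ ‖f x - f y‖) ∧
        ∀ x y, ‖f x - f y‖ ≤ ‖g x - g y‖ + 2 := by
  classical
  -- Adjoining a separate unit vector for each point adds a distance between 1 and 2 to an
  -- orthogonal coordinate.
  refine ⟨WithLp 2 (W × lp (fun _ : L => ℝ) 2), inferInstance, inferInstance, inferInstance,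
    fun x => WithLp.toLp 2 (g x, lp.single 2 x 1), fun x y hxy => ?_, fun x y => ?_, fun x y => ?_⟩
  · rw [← WithLp.toLp_sub, Prod.mk_sub_mk]
    refine le_trans ?_ (WithLp.norm_snd_le _ _)
    refine le_trans ?_ (lp.norm_apply_le_norm two_ne_zero _ x)
    simp [hxy]
  · rw [← WithLp.toLp_sub, Prod.mk_sub_mk]
    exact WithLp.norm_fst_le _ (WithLp.toLp 2 (g x - g y, _))
  · rw [← WithLp.toLp_sub, Prod.mk_sub_mk]
    refine (norm_toLp_le _ _).trans (add_le_add_right ?_ _)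
    refine (norm_sub_le _ _).trans ?_
    rw [lp.norm_single two_pos, lp.norm_single two_pos, norm_one]
    norm_num

/-- `σ` and `d` are arbitrary because a single map `f` on the whole alphabet supplies the
displacement bounds and finite sets for all word spaces at once. -/
theorem coarseDisjointUnionEmbeds_wordStabilizer {A : Type u} {B : Type v} [Group A] [Group B]
    {N : ℕ → Subgroup A} {M : ℕ → Subgroup B} (hN : QuotientsEmbed N) (hM : QuotientsEmbed M)
    {S : Set (Monoid.Coprod A B)} (hSfin : S.Finite) (hS : Subgroup.closure S = ⊤)
    (σ : ℕ → ℕ → ℕ) (d : ℕ → ℕ) :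
    CoarseDisjointUnionEmbeds fun n =>
      schreierMetric S (Monoid.Coprod A B ⧸ wordStabilizer N M (σ n) (d n)) hS := by
  obtain ⟨VA, _, _, _, fA, hUA, hLA⟩ := hN.exists_map
  obtain ⟨VB, _, _, _, fB, hUB, hLB⟩ := hM.exists_map
  have nl : ∀ a : VA, ‖WithLp.toLp 2 (a, (0 : VB))‖ = ‖a‖ := by simp
  have nr : ∀ b : VB, ‖WithLp.toLp 2 ((0 : VA), b)‖ = ‖b‖ := by simp
  let g : (Σ n, A ⧸ N n) ⊕ (Σ n, B ⧸ M n) → WithLp 2 (VA × VB) :=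
    Sum.elim (fun x => WithLp.toLp 2 (fA x, 0)) fun x => WithLp.toLp 2 (0, fB x)
  have gl : ∀ x y, ‖g (Sum.inl x) - g (Sum.inl y)‖ = ‖fA x - fA y‖ := by
    intro x y
    rw [← nl, ← sub_self (0 : VB), ← Prod.mk_sub_mk, WithLp.toLp_sub]
    rfl
  have gr : ∀ x y, ‖g (Sum.inr x) - g (Sum.inr y)‖ = ‖fB x - fB y‖ := by
    intro x y
    rw [← nr, ← sub_self (0 : VA), ← Prod.mk_sub_mk, WithLp.toLp_sub]
    rfl
  obtain ⟨V, _, _, _, f, hsep, hlow, hup⟩ := exists_separated_map g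
  let _ := fun n => MulAction.compHom ((cosetAlphabet N M).Words (σ n) (d n))
    (wordAction N M (σ n) (d n))
  refine coarseDisjointUnionEmbeds_schreier hSfin hS
    (fun n => (cosetAlphabet N M).root (σ n) (d n))
    (fun n w => (cosetAlphabet N M).wordMap f w.1) ?_ ?_
  · intro g
    induction g using Monoid.Coprod.induction_on with
    | inl a =>
      obtain ⟨C, hC⟩ := hUA a
      -- The 2 is the cost of separating points; `max C 0` keeps the bound nonnegative for letters
      -- of the other kind, which stay fixed.
      refine ⟨max C 0 + 2, fun n w => ?_⟩
      change ‖(cosetAlphabet N M).wordMap f (wordAction N M (σ n) (d n) _ w).1 - _‖ ≤ _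
      rw [wordAction_inl, Alphabet.wordHom_apply_val]
      refine Alphabet.norm_wordMap_move_sub_le f w.2 (leftHom N M a).2 ?_
      rintro (x | x)
      · rw [leftHom_inl]
        refine (hup _ _).trans ?_
        rw [gl]
        exact add_le_add_left ((hC x).trans (le_max_left _ _)) _
      · rw [leftHom_inr, sub_self, norm_zero]
        positivity
    | inr b =>
      obtain ⟨C, hC⟩ := hUB b
      refine ⟨max C 0 + 2, fun n w => ?_⟩
      change ‖(cosetAlphabet N M).wordMap f (wordAction N M (σ n) (d n) _ w).1 - _‖ ≤ _
      rw [wordAction_inr, Alphabet.wordHom_apply_val]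
      refine Alphabet.norm_wordMap_move_sub_le f w.2 (rightHom N M b).2 ?_
      rintro (x | x)
      · rw [rightHom_inl, sub_self, norm_zero]
        positivity
      · rw [rightHom_inr]
        refine (hup _ _).trans ?_
        rw [gr]
        exact add_le_add_left ((hC x).trans (le_max_left _ _)) _
    | mul g h ihg ihh =>
      obtain ⟨C, hC⟩ := ihg
      obtain ⟨D, hD⟩ := ihh
      refine ⟨C + D, fun n w => ?_⟩
      rw [mul_smul]
      exact (norm_sub_le_norm_sub_add_norm_sub _ _ _).trans (add_le_add (hC n _) (hD n w))
  · refine Alphabet.exists_finite_wordMap (fun n => wordAction N M (σ n) (d n)) hsep fun R => ?_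
    obtain ⟨EA, hEA, hA⟩ := hLA R
    obtain ⟨EB, hEB, hB⟩ := hLB R
    refine ⟨Monoid.Coprod.inl '' EA ∪ Monoid.Coprod.inr '' EB,
      (hEA.image _).union (hEB.image _), ?_⟩
    rintro (x | x) (y | y) hk hi hR
    · obtain ⟨a, ha, rfl⟩ := hA x y hi (by rw [← gl]; exact (hlow _ _).trans hR)
      exact ⟨_, Or.inl ⟨a, ha, rfl⟩, leftHom N M a, rfl, fun n => wordAction_inl _ _ _ _ a⟩
    · exact absurd hk Bool.false_ne_true
    · exact absurd hk.symm Bool.false_ne_true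
    · obtain ⟨b, hb, rfl⟩ := hB x y hi (by rw [← gr]; exact (hlow _ _).trans hR)
      exact ⟨_, Or.inr ⟨b, hb, rfl⟩, rightHom N M b, rfl, fun n => wordAction_inr _ _ _ _ b⟩

end CoarseUnion

theorem proposition1 {A : Type u} {B : Type v} [Group A] [Group B] [Group.FG A] [Group.FG B]
    [Group.ResiduallyFinite A] [Group.ResiduallyFinite B]
    (S : Set (Monoid.Coprod A B)) (hSfin : S.Finite) (hS : Subgroup.closure S = ⊤) :
    ((∃ N : ℕ → Subgroup A, (⨅ n, N n) = ⊥ ∧ CoarseUnion.QuotientsEmbed N) →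
      (∃ M : ℕ → Subgroup B, (⨅ n, M n) = ⊥ ∧ CoarseUnion.QuotientsEmbed M) →
      ∃ K : ℕ → Subgroup (Monoid.Coprod A B),
        (∀ n, (K n).FiniteIndex) ∧ (⨅ n, K n) = ⊥ ∧
        CoarseUnion.CoarseDisjointUnionEmbeds
          fun n => CoarseUnion.schreierMetric S (Monoid.Coprod A B ⧸ K n) hS) ∧
    ((∃ N : ℕ → Subgroup A, (∀ a ≠ 1, ∀ᶠ n in atTop, a ∉ N n) ∧ CoarseUnion.QuotientsEmbed N) →
      (∃ M : ℕ → Subgroup B, (∀ b ≠ 1, ∀ᶠ n in atTop, b ∉ M n) ∧ CoarseUnion.QuotientsEmbed M) →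
      ∃ K : ℕ → Subgroup (Monoid.Coprod A B),
        (∀ n, (K n).FiniteIndex) ∧ (∀ g ≠ 1, ∀ᶠ n in atTop, g ∉ K n) ∧
        CoarseUnion.CoarseDisjointUnionEmbeds
          fun n => CoarseUnion.schreierMetric S (Monoid.Coprod A B ⧸ K n) hS) := by
  refine ⟨?_, ?_⟩
  · rintro ⟨N, hN, hNE⟩ ⟨M, hM, hME⟩
    -- Every finite pattern of indices must occur, since different syllables may be detected only by
    -- different subgroups. The default 0 of `getD` concerns positions beyond the maximal length,
    -- which hold no letter.
    obtain ⟨τ, hτ⟩ := exists_surjective_nat (List ℕ)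
    exact ⟨_, fun n => CoarseUnion.finiteIndex_wordStabilizer _ _ hNE.1 hME.1,
      CoarseUnion.iInf_wordStabilizer hN hM hτ,
      CoarseUnion.coarseDisjointUnionEmbeds_wordStabilizer hNE hME hSfin hS _ _⟩
  · rintro ⟨N, hN, hNE⟩ ⟨M, hM, hME⟩
    exact ⟨_, fun n => CoarseUnion.finiteIndex_wordStabilizer _ _ hNE.1 hME.1,
      fun g hg => CoarseUnion.eventually_notMem_wordStabilizer hN hM hg,
      CoarseUnion.coarseDisjointUnionEmbeds_wordStabilizer hNE hME hSfin hS _ _⟩
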